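/- A group $T$ is called freely telescopic if for every finite group $\Gamma$ there exists a finite-index subgroup $H \leq T$ such that $H$ is a free group and $N_T(H)/H \cong \Gamma$, where $N_T(H) = \{g \in T : gHg^{-1} = H\}$ denotes the normaliser of $H$ in $T$. **Proposition.** The free product $\mathbb{Z}_2 * \mathbb{Z}_2 * \mathbb{Z}_2$ of three cyclic groups of order two is freely telescopic. -/

import Mathlib

universe v u

/-- The quotient `N_T(H) / H` of the normaliser of a subgroup `H` of `T` by `H`, where `H` is
regarded as a (normal) subgroup of its normaliser. -/
abbrev NormalizerQuotient {T : Type*} [Group T] (H : Subgroup T) : Type _ :=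
  Subgroup.normalizer (H : Set T) ⧸ H.subgroupOf (Subgroup.normalizer (H : Set T))

/-- `T` is freely telescopic if for every finite group `Γ` there is a finite-index subgroup
`H ≤ T` that is a free group and satisfies `N_T(H) / H ≅ Γ`. -/
def IsFreelyTelescopic (T : Type u) [Group T] : Prop :=
  ∀ (Γ : Type v) [Group Γ] [Finite Γ],
    ∃ H : Subgroup T, H.FiniteIndex ∧ IsFreeGroup H ∧ Nonempty (NormalizerQuotient H ≃* Γ)

/-- The free product `ℤ₂ ∗ ℤ₂ ∗ ℤ₂` of three cyclic groups of order two. -/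
abbrev FreeProductZ2Z2Z2 : Type :=
  Monoid.CoprodI (fun _ : Fin 3 => Multiplicative (ZMod 2))

open Equiv

namespace FreeProductZ2Z2Z2

/-! Let the generators swap two copies (sheets) of `Γ × ℤ/(n+6)`, commuting with right
multiplication by `Γ`. A stabilizer `H` contains only even words, and these form a free group on `a
= gen 0 * gen 1` and `b = gen 0 * gen 2`; so `H` is free, and of finite index since the set is
finite. The normaliser moves the base point only to points fixed by `H`. If those are exactly its
`Γ`-translates, all in its orbit, the quotient is `Γ`. The permutations are chosen so that two
coincidences of words at the base point, `a = b` and `a³ = b²`, exclude all other points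
(`eq_of_fixed`). -/

/-- The generator of the `i`-th factor of `ℤ₂ ∗ ℤ₂ ∗ ℤ₂`. -/
def gen (i : Fin 3) : FreeProductZ2Z2Z2 :=
  Monoid.CoprodI.of (M := fun _ : Fin 3 => Multiplicative (ZMod 2)) (i := i)
    (Multiplicative.ofAdd 1)

theorem gen_mul_self (i : Fin 3) : gen i * gen i = 1 := by
  have h : (Multiplicative.ofAdd (1 : ZMod 2)) * Multiplicative.ofAdd 1 = 1 := by decide
  rw [gen, ← map_mul, h, map_one]

theorem gen_mul_gen_mul (i : Fin 3) (t : FreeProductZ2Z2Z2) : gen i * (gen i * t) = t := by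
  rw [← mul_assoc, gen_mul_self, one_mul]

theorem gen_inv (i : Fin 3) : (gen i)⁻¹ = gen i :=
  inv_eq_of_mul_eq_one_left (gen_mul_self i)

/-- Induction on words in the three generators. -/
theorem gen_induction {P : FreeProductZ2Z2Z2 → Prop} (one : P 1)
    (mul : ∀ i t, P t → P (gen i * t)) (t : FreeProductZ2Z2Z2) : P t := by
  induction t using Monoid.CoprodI.induction_left with
  | one => exact one
  | mul m x hx =>
    rename_i i
    have hm : m = 1 ∨ m = Multiplicative.ofAdd 1 := by
      revert m; decide
    rcases hm with rfl | rfl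
    · simpa using hx
    · exact mul i x hx

/-- The homomorphism from a cyclic group of order two determined by an involution. -/
def involutionHom {G : Type*} [Group G] (g : G) (hg : g * g = 1) :
    Multiplicative (ZMod 2) →* G :=
  AddMonoidHom.toMultiplicativeLeft
    (ZMod.lift 2 ⟨zmultiplesHom (Additive G) (Additive.ofMul g), by
      simpa [two_zsmul] using congrArg Additive.ofMul hg⟩)

theorem involutionHom_ofAdd_one {G : Type*} [Group G] (g : G) (hg : g * g = 1) :
    involutionHom g hg (Multiplicative.ofAdd 1) = g := by
  have h := ZMod.lift_coe 2 ⟨zmultiplesHom (Additive G) (Additive.ofMul g), by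
      simpa [two_zsmul] using congrArg Additive.ofMul hg⟩ 1
  simp only [Int.cast_one] at h
  simp [involutionHom, h]

/-! ### Two-sheeted actions and the even subgroup -/

/-- The involution of `W × Bool` that exchanges the two copies of `W`, by `p` from the first copy
to the second one. -/
def exchange {W : Type*} (p : Perm W) : Perm (W × Bool) :=
  Function.Involutive.toPerm
    (fun x => bif x.2 then (p⁻¹ x.1, false) else (p x.1, true))
    (by rintro ⟨w, _ | _⟩ <;> simp)

@[simp] theorem exchange_false {W : Type*} (p : Perm W) (w : W) :
    exchange p (w, false) = (p w, true) := rfl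

@[simp] theorem exchange_true {W : Type*} (p : Perm W) (w : W) :
    exchange p (w, true) = (p⁻¹ w, false) := rfl

theorem exchange_mul_self {W : Type*} (p : Perm W) : exchange p * exchange p = 1 := by
  ext1 x
  exact Function.Involutive.toPerm_involutive _ x

/-- The action of `ℤ₂ ∗ ℤ₂ ∗ ℤ₂` on `W × Bool` in which the generators exchange the two copies
of `W` by the given permutations. -/
def exchangeHom {W : Type*} (p : Fin 3 → Perm W) : FreeProductZ2Z2Z2 →* Perm (W × Bool) :=
  Monoid.CoprodI.lift fun i => involutionHom (exchange (p i)) (exchange_mul_self _)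

@[simp] theorem exchangeHom_gen {W : Type*} (p : Fin 3 → Perm W) (i : Fin 3) :
    exchangeHom p (gen i) = exchange (p i) := by
  rw [exchangeHom, gen, Monoid.CoprodI.lift_of, involutionHom_ofAdd_one]

theorem exchangeHom_map {W : Type*} (p : Fin 3 → Perm W) (r : W → W)
    (hr : ∀ i w, p i (r w) = r (p i w)) (t : FreeProductZ2Z2Z2) (x : W × Bool) :
    exchangeHom p t (r x.1, x.2) =
      (r (exchangeHom p t x).1, (exchangeHom p t x).2) := by
  induction t using gen_induction with
  | one => simp
  | mul i t ih =>
    rw [map_mul, Perm.mul_apply, ih, Perm.mul_apply, exchangeHom_gen]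
    rcases exchangeHom p t x with ⟨w, _ | _⟩
    · simp [hr]
    · simp only [exchange_true, Prod.mk.injEq, and_true]
      rw [Perm.inv_eq_iff_eq, hr, ← Perm.mul_apply, mul_inv_cancel, Perm.one_apply]

/-- The embedding of the free group of rank two as the group of words of even length. -/
def evenHom : FreeGroup (Fin 2) →* FreeProductZ2Z2Z2 :=
  FreeGroup.lift fun i => gen 0 * gen i.succ

@[simp] theorem evenHom_of (i : Fin 2) : evenHom (FreeGroup.of i) = gen 0 * gen i.succ := by
  simp [evenHom]

theorem exists_evenHom_eq (t : FreeProductZ2Z2Z2) :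
    ∃ w, t = evenHom w ∨ t = gen 0 * evenHom w := by
  induction t using gen_induction with
  | one => exact ⟨1, Or.inl (map_one _).symm⟩
  | mul i t ih =>
    obtain ⟨w, rfl | rfl⟩ := ih
    · cases i using Fin.cases with
      | zero => exact ⟨w, Or.inr rfl⟩
      | succ i =>
        exact ⟨FreeGroup.of i * w, Or.inr (by
          rw [map_mul, evenHom_of, mul_assoc, gen_mul_gen_mul])⟩
    · cases i using Fin.cases with
      | zero => exact ⟨w, Or.inl (gen_mul_gen_mul 0 _)⟩
      | succ i =>
        exact ⟨(FreeGroup.of i)⁻¹ * w, Or.inl (by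
          rw [map_mul, map_inv, evenHom_of, mul_inv_rev, gen_inv, gen_inv, mul_assoc])⟩

/-- Even words act on the first copy of `W` through the free group. -/
theorem exchangeHom_evenHom {W : Type*} (p : Fin 3 → Perm W) (hp : p 0 = 1)
    (v : FreeGroup (Fin 2)) (w : W) :
    exchangeHom p (evenHom v) (w, false) =
      (FreeGroup.lift (fun i : Fin 2 => p i.succ) v w, false) := by
  induction v using FreeGroup.induction_on generalizing w with
  | C1 => simp
  | of i => simp [hp]
  | inv_of i _ =>
    rw [map_inv, map_inv, Perm.inv_eq_iff_eq]
    simp [hp]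
  | mul x y hx hy => rw [map_mul, map_mul, Perm.mul_apply, hy, hx, map_mul, Perm.mul_apply]

/-- The action built from left translations restricts on the first sheet to the regular action of
the free group, which is faithful. -/
theorem evenHom_injective : Function.Injective evenHom := by
  let p : Fin 3 → Perm (FreeGroup (Fin 2)) :=
    Fin.cons 1 fun i => Equiv.mulLeft (FreeGroup.of i)
  have key : FreeGroup.lift (fun i : Fin 2 => p i.succ) =
      MulAction.toPermHom (FreeGroup (Fin 2)) (FreeGroup (Fin 2)) := by
    ext i x
    simp [p]
  intro v w h
  have hv := exchangeHom_evenHom p rfl v 1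
  rw [h, exchangeHom_evenHom p rfl w 1, key] at hv
  simpa using hv.symm

instance isFreeGroup_range_evenHom : IsFreeGroup evenHom.range :=
  IsFreeGroup.ofMulEquiv (MonoidHom.ofInjective evenHom_injective)

/-! ### Point stabilizers and their normalisers -/

/-- The stabilizer of a point for an action given by a homomorphism. -/
abbrev pointStabilizer {G X : Type*} [Group G] (ρ : G →* Perm X) (x : X) : Subgroup G :=
  (MulAction.stabilizer (Perm X) x).comap ρ

theorem finiteIndex_pointStabilizer {G X : Type*} [Group G] [Finite X] (ρ : G →* Perm X) (x : X) :
    (pointStabilizer ρ x).FiniteIndex := by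
  rw [Subgroup.finiteIndex_iff, Subgroup.index_comap]
  have := Subgroup.isFiniteRelIndex_of_finiteIndex (H := MulAction.stabilizer (Perm X) x)
    (K := ρ.range)
  exact this.relIndex_ne_zero

/-- Odd words change the sheet, so the stabilizer lies in the free group of even words;
Nielsen–Schreier applies. -/
theorem isFreeGroup_pointStabilizer {W : Type*} (p : Fin 3 → Perm W) (hp : p 0 = 1) (w : W) :
    IsFreeGroup (pointStabilizer (exchangeHom p) (w, false)) := by
  have hle : pointStabilizer (exchangeHom p) (w, false) ≤ evenHom.range := by
    intro t ht
    obtain ⟨v, rfl | rfl⟩ := exists_evenHom_eq t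
    · exact ⟨v, rfl⟩
    · have ht' : exchangeHom p (gen 0 * evenHom v) (w, false) = (w, false) := ht
      rw [map_mul, Perm.mul_apply, exchangeHom_evenHom p hp, exchangeHom_gen] at ht'
      simp at ht'
  exact IsFreeGroup.ofMulEquiv (Subgroup.subgroupOfEquivOfLe hle)

/-- If a group acts on `(Γ × Z) × Bool` commuting with right multiplication by `Γ`, and the points
fixed by the stabilizer of a point are those of its `Γ`-orbit and lie in its `G`-orbit, then the
stabilizer has normaliser quotient `Γ`. -/
theorem nonempty_normalizerQuotient_mulEquiv {G Γ Z : Type*} [Group G] [Group Γ]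
    (ρ : G →* Perm ((Γ × Z) × Bool)) (z : Z)
    (comm : ∀ (t : G) (k : Γ) (x : (Γ × Z) × Bool), ρ t ((x.1.1 * k, x.1.2), x.2) =
      (((ρ t x).1.1 * k, (ρ t x).1.2), (ρ t x).2))
    (trans : ∀ k : Γ, ∃ t, ρ t ((1, z), false) = ((k, z), false))
    (fixed : ∀ x, (∀ t, ρ t ((1, z), false) = ((1, z), false) → ρ t x = x) →
      x.1.2 = z ∧ x.2 = false) :
    Nonempty (NormalizerQuotient (pointStabilizer ρ ((1, z), false)) ≃* Γ) := by
  set H := pointStabilizer ρ ((1, z), false)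
  have mem (t : G) : t ∈ H ↔ ρ t ((1, z), false) = ((1, z), false) := Iff.rfl
  have move (t : G) (k : Γ) : ρ t ((k, z), false) =
      (((ρ t ((1, z), false)).1.1 * k, (ρ t ((1, z), false)).1.2), (ρ t ((1, z), false)).2) := by
    simpa using comm t k ((1, z), false)
  have image (t : Subgroup.normalizer (H : Set G)) :
      ρ t ((1, z), false) = (((ρ t ((1, z), false)).1.1, z), false) := by
    -- As `t` normalises `H`, every element of `H` fixes the image of the base point under `t`.
    obtain ⟨h₁, h₂⟩ := fixed (ρ t ((1, z), false)) fun s hs => by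
      have := (Subgroup.mem_normalizer_iff''.1 t.2 s).1 hs
      have h := (mem _).1 this
      rw [map_mul, map_mul, map_inv, Perm.mul_apply, Perm.mul_apply, Perm.inv_eq_iff_eq] at h
      exact h
    exact Prod.ext (Prod.ext rfl h₁) h₂
  let φ : Subgroup.normalizer (H : Set G) →* Γ :=
    MonoidHom.mk' (fun t => (ρ t ((1, z), false)).1.1) fun s t => by
      rw [Subgroup.coe_mul, map_mul, Perm.mul_apply, image t, move]
  have hφ : Function.Surjective φ := by
    intro k
    obtain ⟨t, ht⟩ := trans k
    refine ⟨⟨t, Subgroup.mem_normalizer_iff''.2 fun s => ?_⟩, by simp [φ, ht]⟩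
    rw [mem, mem, map_mul, map_mul, map_inv, Perm.mul_apply, Perm.mul_apply, Perm.inv_eq_iff_eq,
      ht, move s k]
    simp [Prod.ext_iff]
  have ker : H.subgroupOf (Subgroup.normalizer (H : Set G)) = φ.ker := by
    ext t
    rw [Subgroup.mem_subgroupOf, mem, MonoidHom.mem_ker, image t]
    simp [φ]
  exact ⟨(QuotientGroup.quotientMulEquivOfEq ker).trans
    (QuotientGroup.quotientKerEquivOfSurjective φ hφ)⟩

/-! ### The explicit finite action -/

/-- The three-cycle `0 ↦ 1 ↦ 3 ↦ 0`. -/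
def tricycle (n : ℕ) : Perm (ZMod (n + 6)) := swap 0 1 * swap 1 3

theorem natCast_ne_natCast_of_lt {n j k : ℕ} (hj : j < k) (hk : k < n) :
    (j : ZMod n) ≠ (k : ZMod n) := by
  intro h
  have := congrArg ZMod.val h
  rw [ZMod.val_natCast_of_lt (hj.trans hk), ZMod.val_natCast_of_lt hk] at this
  lia

theorem tricycle_zero (n : ℕ) : tricycle n 0 = 1 := by
  have h1 := natCast_ne_natCast_of_lt (n := n + 6) (j := 0) (k := 1) (by lia) (by lia)
  have h3 := natCast_ne_natCast_of_lt (n := n + 6) (j := 0) (k := 3) (by lia) (by lia)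
  push_cast at h1 h3
  rw [tricycle, Perm.mul_apply, swap_apply_of_ne_of_ne h1 h3, swap_apply_left]

theorem tricycle_one (n : ℕ) : tricycle n 1 = 3 := by
  have h1 := natCast_ne_natCast_of_lt (n := n + 6) (j := 1) (k := 3) (by lia) (by lia)
  have h0 := natCast_ne_natCast_of_lt (n := n + 6) (j := 0) (k := 3) (by lia) (by lia)
  push_cast at h1 h0
  rw [tricycle, Perm.mul_apply, swap_apply_left, swap_apply_of_ne_of_ne h0.symm h1.symm]

theorem tricycle_three (n : ℕ) : tricycle n 3 = 0 := by
  rw [tricycle, Perm.mul_apply, swap_apply_right, swap_apply_right]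

theorem tricycle_of_ne {n : ℕ} {z : ZMod (n + 6)} (h0 : z ≠ 0) (h1 : z ≠ 1) (h3 : z ≠ 3) :
    tricycle n z = z := by
  rw [tricycle, Perm.mul_apply, swap_apply_of_ne_of_ne h1 h3, swap_apply_of_ne_of_ne h0 h1]

theorem tricycle_eq_add_one {n : ℕ} {z : ZMod (n + 6)} (h : tricycle n z = z + 1) : z = 0 := by
  have h1 := natCast_ne_natCast_of_lt (n := n + 6) (j := 0) (k := 1) (by lia) (by lia)
  have h4 := natCast_ne_natCast_of_lt (n := n + 6) (j := 0) (k := 4) (by lia) (by lia)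
  push_cast at h1 h4
  by_contra hz0
  by_cases hz1 : z = 1
  · subst hz1
    rw [tricycle_one] at h
    exact h1 (by linear_combination -h)
  by_cases hz3 : z = 3
  · subst hz3
    rw [tricycle_three] at h
    exact h4 (by linear_combination h)
  rw [tricycle_of_ne hz0 hz1 hz3] at h
  exact h1 (by linear_combination h)

theorem tricycle_neg_two_ne_zero (n : ℕ) : tricycle n (-2) ≠ 0 := by
  have h5 := natCast_ne_natCast_of_lt (n := n + 6) (j := 0) (k := 5) (by lia) (by lia)
  push_cast at h5
  intro h
  have h' := (tricycle n).injective (h.trans (tricycle_three n).symm)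
  exact h5 (by linear_combination h')

/-- The permutation of `Γ × Z` covering `s` with left multiplication by `m`. -/
def skew {Γ Z : Type*} [Group Γ] (m : Z → Γ) (s : Perm Z) : Perm (Γ × Z) where
  toFun x := (m x.2 * x.1, s x.2)
  invFun x := ((m (s⁻¹ x.2))⁻¹ * x.1, s⁻¹ x.2)
  left_inv x := by simp
  right_inv x := by simp

@[simp] theorem skew_apply {Γ Z : Type*} [Group Γ] (m : Z → Γ) (s : Perm Z) (x : Γ × Z) :
    skew m s x = (m x.2 * x.1, s x.2) := rfl

@[simp] theorem skew_inv_apply {Γ Z : Type*} [Group Γ] (m : Z → Γ) (s : Perm Z) (x : Γ × Z) :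
    (skew m s)⁻¹ x = ((m (s⁻¹ x.2))⁻¹ * x.1, s⁻¹ x.2) := rfl

/-- The permutations by which the three generators exchange the copies of `Γ × ℤ/(n + 6)`. -/
def coverPerm {Γ : Type*} [Group Γ] {n : ℕ} (m : ZMod (n + 6) → Γ) :
    Fin 3 → Perm (Γ × ZMod (n + 6)) :=
  ![1, skew 1 (Equiv.addRight 1), skew m (tricycle n)]

theorem exists_label (Γ : Type*) [Group Γ] [Finite Γ] : ∃ m : ZMod (Nat.card Γ + 6) → Γ,
    m 0 = 1 ∧ m 1 = 1 ∧ ∀ k, ∃ z, tricycle _ z = z ∧ m z = k := by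
  let e := Finite.equivFin Γ
  have hval (i : Fin (Nat.card Γ)) : ((i + 6 : ℕ) : ZMod (Nat.card Γ + 6)).val = i + 6 :=
    ZMod.val_natCast_of_lt (by lia)
  -- The residues from 6 on are fixed by the three-cycle and enumerate `Γ`; smaller ones get the
  -- trivial label.
  refine ⟨fun z => if h : 6 ≤ z.val then e.symm ⟨z.val - 6, ?_⟩ else 1, ?_, ?_, fun k =>
    ⟨((e k + 6 : ℕ) : ZMod (Nat.card Γ + 6)), ?_, ?_⟩⟩
  · have := z.val_lt
    lia
  · simp
  · have : (1 : ZMod (Nat.card Γ + 6)).val = 1 := by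
      simpa using ZMod.val_natCast_of_lt (n := Nat.card Γ + 6) (a := 1) (by lia)
    simp [this]
  · have hne (j : ℕ) (hj : j < 6) : ((e k + 6 : ℕ) : ZMod (Nat.card Γ + 6)) ≠ (j : ℕ) := by
      intro h
      have := congrArg ZMod.val h
      rw [hval, ZMod.val_natCast_of_lt (by lia)] at this
      lia
    have h0 := hne 0 (by lia)
    have h1 := hne 1 (by lia)
    have h3 := hne 3 (by lia)
    rw [Nat.cast_zero] at h0
    rw [Nat.cast_one] at h1
    rw [Nat.cast_ofNat] at h3
    exact tricycle_of_ne h0 h1 h3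
  · simp only [hval]
    simp

theorem skew_one_addRight_pow {Γ : Type*} [Group Γ] {n : ℕ} (k : ℕ) (x : Γ × ZMod n) :
    (skew 1 (Equiv.addRight 1) ^ k : Perm (Γ × ZMod n)) x = (x.1, x.2 + k) := by
  induction k with
  | zero => simp
  | succ k ih =>
    rw [pow_succ', Perm.mul_apply, ih]
    simp [add_assoc]

section Cover

variable {Γ : Type*} [Group Γ] {n : ℕ} (m : ZMod (n + 6) → Γ)

theorem exchangeHom_coverPerm_mul_right (t : FreeProductZ2Z2Z2) (k : Γ)
    (x : (Γ × ZMod (n + 6)) × Bool) :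
    exchangeHom (coverPerm m) t ((x.1.1 * k, x.1.2), x.2) =
      (((exchangeHom (coverPerm m) t x).1.1 * k, (exchangeHom (coverPerm m) t x).1.2),
        (exchangeHom (coverPerm m) t x).2) := by
  refine exchangeHom_map (coverPerm m) (fun w => (w.1 * k, w.2)) (fun i w => ?_) t x
  fin_cases i <;> simp [coverPerm, mul_assoc]

theorem exists_exchangeHom_coverPerm_eq
    (hm : ∀ k, ∃ z, tricycle n z = z ∧ m z = k) (k : Γ) :
    ∃ t, exchangeHom (coverPerm m) t ((1, 0), false) = ((k, 0), false) := by
  obtain ⟨z, hz, hk⟩ := hm k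
  let x : FreeGroup (Fin 2) := FreeGroup.of 0
  -- Walk from 0 to `z`, pick up the label `k` at the fixed point `z`, walk back.
  refine ⟨evenHom ((x ^ z.val)⁻¹ * (FreeGroup.of 1 * x ^ z.val)), ?_⟩
  rw [exchangeHom_evenHom _ rfl, map_mul, map_inv, Perm.mul_apply]
  congr 1
  rw [Perm.inv_eq_iff_eq, map_mul, Perm.mul_apply, map_pow]
  simp [x, coverPerm, skew_one_addRight_pow, hz, hk]

theorem eq_of_fixed (h0 : m 0 = 1) (h1 : m 1 = 1) (x : (Γ × ZMod (n + 6)) × Bool)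
    (hx : ∀ t, exchangeHom (coverPerm m) t ((1, 0), false) = ((1, 0), false) →
      exchangeHom (coverPerm m) t x = x) : x.1.2 = 0 ∧ x.2 = false := by
  have transfer (s t : FreeProductZ2Z2Z2)
      (h : exchangeHom (coverPerm m) s ((1, 0), false) =
        exchangeHom (coverPerm m) t ((1, 0), false)) :
      exchangeHom (coverPerm m) s x = exchangeHom (coverPerm m) t x := by
    have := hx (s⁻¹ * t) (by rw [map_mul, map_inv, Perm.mul_apply, Perm.inv_eq_iff_eq, h])
    rw [map_mul, map_inv, Perm.mul_apply, Perm.inv_eq_iff_eq] at this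
    exact this.symm
  -- At the base point `a` and `b` both lead to 1, while `a³` and `b²` both lead to 3, all with
  -- trivial labels.
  have e1 := transfer (gen 0 * gen 1) (gen 0 * gen 2) (by simp [coverPerm, tricycle_zero, h0])
  have e2 := transfer (gen 0 * gen 1 * (gen 0 * gen 1) * (gen 0 * gen 1))
    (gen 0 * gen 2 * (gen 0 * gen 2)) (by
      simp [coverPerm, tricycle_zero, h0, tricycle_one, h1]; norm_num)
  obtain ⟨⟨k, z⟩, _ | _⟩ := x
  · simp only [map_mul, Perm.mul_apply, exchangeHom_gen, coverPerm] at e1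
    simp at e1
    exact ⟨tricycle_eq_add_one e1.2.symm, rfl⟩
  -- On the second sheet `a` and `b` act by the inverse permutations: `e1` forces `z = 1`, and then
  -- `e2` makes the three-cycle send -2 to 0.
  · exfalso
    simp [coverPerm] at e1 e2
    have f1 := e1.2
    have f2 := e2.2
    rw [← f1, Equiv.eq_symm_apply] at f2
    rw [Equiv.eq_symm_apply] at f1
    have hz := tricycle_eq_add_one (z := z + -1) (by rw [f1]; ring)
    refine tricycle_neg_two_ne_zero n ?_
    rw [hz] at f2
    convert f2 using 2
    ring

end Cover

end FreeProductZ2Z2Z2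

open FreeProductZ2Z2Z2 in
theorem mainTheorem8 : IsFreelyTelescopic.{v} FreeProductZ2Z2Z2 := by
  intro Γ _ _
  obtain ⟨m, h0, h1, hm⟩ := exists_label Γ
  exact ⟨pointStabilizer (exchangeHom (coverPerm m)) ((1, 0), false),
    finiteIndex_pointStabilizer _ _,
    isFreeGroup_pointStabilizer _ rfl _,
    nonempty_normalizerQuotient_mulEquiv _ 0 (exchangeHom_coverPerm_mul_right m)
      (exists_exchangeHom_coverPerm_eq m hm) (eq_of_fixed m h0 h1)⟩
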